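/- Let $\mathcal G$ be a causal diagram on a finite vertex set $\mathbf V$, i.e. an acyclic graph with directed edges $\to$ and bidirected edges $\leftrightarrow$, and let $Y\in\mathbf V$ be the reward variable. Sets of ancestors $\mathtt{An}$ and descendants $\mathtt{De}$ include the given set; $\mathtt{Pa}(\mathbf S)$ is the set of parents of members of $\mathbf S$; $\mathcal G_{\overline{\mathbf X}}$ is $\mathcal G$ without the edges that have an arrowhead at a vertex of $\mathbf X$; $\mathcal G[\mathbf S]$ is the induced subgraph. *Possibly-optimal intervention sets.* Consider structural causal models whose endogenous variables $\mathbf V$ have finite domains, with $Y$ real-valued and with mutually independent exogenous variables, and whose causal diagram is $\mathcal G$ ($A\to B$ iff $A$ is an argument of the function of $B$; $A\leftrightarrow B$ iff $A\ne B$ share an exogenous variable). Two sets $\mathbf R,\mathbf W\subseteq\mathbf V\setminus\{Y\}$ are *equivalent* if in every such model every joint assignment $\mathbf v$ of values to $\mathbf V$ satisfies $\mathbb E_{\mathbf v[\mathbf R]}Y=\mathbb E_{\mathbf v[\mathbf W]}Y$, where $\mathbb E_{\mathbf v[\mathbf R]}$ is the expectation under the intervention $do(\mathbf R=\mathbf v[\mathbf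 R])$. A set $\mathbf R\subseteq\mathtt{An}(Y)_{\mathcal G}\setminus\{Y\}$ is a *POIS* with respect to $\langle\mathcal G,Y\rangle$ if there is such a model in which $\max_{\mathbf r}\mathbb E_{\mathbf r}Y>\max_{\mathbf w}\mathbb E_{\mathbf w}Y$ for every $\mathbf W\subseteq\mathbf V\setminus\{Y\}$ that is not equivalent to $\mathbf R$. *Algorithm.* For a diagram $\mathcal H$ containing $Y$, $\mathsf{MUCT}(\mathcal H,Y)$ is the smallest vertex set of $\mathcal H'=\mathcal H[\mathtt{An}(Y)_{\mathcal H}]$ that contains $Y$ and is closed under descendants and under bidirected connection in $\mathcal H'$; with $\mathbf T=\mathsf{MUCT}(\mathcal H,Y)$, $\mathsf{IB}(\mathcal H,Y)=\mathtt{Pa}(\mathbf T)_{\mathcal H}\setminus\mathbf T$. Write $\mathcal F(\mathbf X,\mathbf T)=\{\mathbf R:\mathbf X\subseteq\mathbf R\subseteq\mathtt{An}(\mathbf T)_{\mathcal G}\setminus\mathbf T\}$, where $\mathcal G$ is always the input diagram. - $\mathsf{POISs}(\mathcal G,Y)$: put $\mathbf T=\mathsf{MUCT}(\mathcal G,Y)$,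 $\mathbf X=\mathsf{IB}(\mathcal G,Y)$, $\mathcal Q=\mathcal G_{\overline{\mathbf X}}[\mathbf T\cup\mathbf X]$; let $\pi$ be the reverse of a topological sort of $\mathcal Q$, with $Y$ removed; return $\mathcal F(\mathbf X,\mathbf T)\cup\mathsf{subPOISs}(\mathcal Q,Y,\pi,\emptyset)$. - $\mathsf{subPOISs}(\mathcal H,Y,\pi,\mathbf O)$: start from $\mathbf P=\emptyset$. For $i=1,\dots,|\pi|$ put $\mathbf T=\mathsf{MUCT}(\mathcal H_{\overline{\pi[i]}},Y)$, $\mathbf X=\mathsf{IB}(\mathcal H_{\overline{\pi[i]}},Y)$, $\pi'=\pi[i+1:]$, $\mathbf O'=\mathbf O\cup\pi[1:i-1]$; if $\mathbf X\cap\mathbf O'=\emptyset$, add to $\mathbf P$ the family $\mathcal F(\mathbf X,\mathbf T)$ and, if $\pi'\neq\emptyset$, also $\mathsf{subPOISs}(\mathcal H_{\overline{\mathbf X}}[\mathbf T\cup\mathbf X],Y,\pi',\mathbf O')$. After the loop return $\mathbf P$. **Proposition.** $\mathcal Q$ has a topological sort, and whichever topological sort of $\mathcal Q$ is used, $\mathsf{POISs}(\mathcal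 G,Y)$ returns all, and only, the POISs with respect to $\langle\mathcal G,Y\rangle$: for every $\mathbf R\subseteq\mathbf V$, $\mathbf R\in\mathsf{POISs}(\mathcal G,Y)$ if and only if $\mathbf R$ is a POIS with respect to $\langle\mathcal G,Y\rangle$. -/

import Mathlib

open MeasureTheory

universe u

/-- A causal diagram: an acyclic directed mixed graph on a finite vertex set `verts`, with
directed edges `dir a b` (that is, `a → b`) and bidirected edges `bi a b` (that is, `a ↔ b`). -/
structure CausalDiagram (V : Type u) where
  verts : Finset V
  dir : V → V → Prop
  bi : V → V → Prop
  dir_mem : ∀ a b, dir a b → a ∈ verts ∧ b ∈ verts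
  bi_mem : ∀ a b, bi a b → a ∈ verts ∧ b ∈ verts
  acyclic : ∀ a, ¬ Relation.TransGen dir a a
  bi_symm : ∀ a b, bi a b → bi b a
  bi_irrefl : ∀ a, ¬ bi a a

namespace CausalDiagram

variable {V : Type u} [Fintype V] [DecidableEq V]

/-- `G_{\overline X}`: delete every edge with an arrowhead at a vertex of `X`. -/
def cutIncoming (G : CausalDiagram V) (X : Finset V) : CausalDiagram V where
  verts := G.verts
  dir a b := G.dir a b ∧ b ∉ X
  bi a b := G.bi a b ∧ a ∉ X ∧ b ∉ X
  dir_mem a b h := G.dir_mem a b h.1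
  bi_mem a b h := G.bi_mem a b h.1
  acyclic a h := G.acyclic a (Relation.TransGen.mono (fun _ _ h => h.1) a a h)
  bi_symm a b h := ⟨G.bi_symm a b h.1, h.2.2, h.2.1⟩
  bi_irrefl a h := G.bi_irrefl a h.1

/-- `G[S]`: the subgraph induced by `S`. -/
def induce (G : CausalDiagram V) (S : Finset V) : CausalDiagram V where
  verts := G.verts ∩ S
  dir a b := G.dir a b ∧ a ∈ S ∧ b ∈ S
  bi a b := G.bi a b ∧ a ∈ S ∧ b ∈ S
  dir_mem a b h := by
    have := G.dir_mem a b h.1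
    simp [this, h.2]
  bi_mem a b h := by
    have := G.bi_mem a b h.1
    simp [this, h.2]
  acyclic a h := G.acyclic a (Relation.TransGen.mono (fun _ _ h => h.1) a a h)
  bi_symm a b h := ⟨G.bi_symm a b h.1, h.2.2, h.2.1⟩
  bi_irrefl a h := G.bi_irrefl a h.1

open Classical in
/-- Parents of a member of `S`. -/
noncomputable def parents (G : CausalDiagram V) (S : Finset V) : Finset V :=
  G.verts.filter fun v => ∃ s ∈ S, G.dir v s

open Classical in
/-- Ancestors of `S`, the vertices of `S` included. -/
noncomputable def ancestors (G : CausalDiagram V) (S : Finset V) : Finset V :=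
  G.verts.filter fun v => ∃ s ∈ S, Relation.ReflTransGen G.dir v s

open Classical in
/-- Descendants of `S`, the vertices of `S` included. -/
noncomputable def descendants (G : CausalDiagram V) (S : Finset V) : Finset V :=
  G.verts.filter fun v => ∃ s ∈ S, Relation.ReflTransGen G.dir s v

open Classical in
/-- The union of the c-components (connected components for the bidirected edges) that
meet `S`. -/
noncomputable def cComponents (G : CausalDiagram V) (S : Finset V) : Finset V :=
  G.verts.filter fun v => ∃ s ∈ S, Relation.ReflTransGen G.bi s v

/-- `T` is a UC-territory on `G` with respect to `Y`: with `H = G[An(Y)]`, it is a set of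
vertices of `H` that contains `Y` and is closed under descendants and c-components in `H`. -/
def IsUCTerritory (G : CausalDiagram V) (Y : V) (T : Finset V) : Prop :=
  T ⊆ (G.induce (G.ancestors {Y})).verts ∧ Y ∈ T ∧
    (G.induce (G.ancestors {Y})).descendants T = T ∧
    (G.induce (G.ancestors {Y})).cComponents T = T

open Classical in
/-- The minimal UC-territory, as the intersection of all UC-territories; see
`muct_isUCTerritory` and `eq_muct_iff_minimal`. -/
noncomputable def muct (G : CausalDiagram V) (Y : V) : Finset V :=
  G.verts.filter fun v => ∀ T, G.IsUCTerritory Y T → v ∈ T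

/-- The interventional border `Pa(T) \ T` of the minimal UC-territory `T`. -/
noncomputable def interventionalBorder (G : CausalDiagram V) (Y : V) : Finset V :=
  G.parents (G.muct Y) \ G.muct Y

lemma muct_subset {G : CausalDiagram V} {Y : V} {T : Finset V} (hT : G.IsUCTerritory Y T) :
    G.muct Y ⊆ T := by
  intro v hv
  simp only [muct, Finset.mem_filter] at hv
  exact hv.2 T hT

lemma muct_isUCTerritory (G : CausalDiagram V) {Y : V} (hY : Y ∈ G.verts) :
    G.IsUCTerritory Y (G.muct Y) := by
  set H := G.induce (G.ancestors {Y}) with hH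
  have hYH : Y ∈ H.verts := by
    simp only [hH, induce, ancestors, Finset.mem_inter, Finset.mem_filter]
    exact ⟨hY, hY, Y, by simp, Relation.ReflTransGen.refl⟩
  have hHG : H.verts ⊆ G.verts := Finset.inter_subset_left
  have hfull : G.IsUCTerritory Y H.verts := by
    refine ⟨subset_rfl, hYH, ?_, ?_⟩
    · ext v
      simp only [descendants, Finset.mem_filter]
      exact ⟨fun h => h.1, fun h => ⟨h, v, h, Relation.ReflTransGen.refl⟩⟩
    · ext v
      simp only [cComponents, Finset.mem_filter]
      exact ⟨fun h => h.1, fun h => ⟨h, v, h, Relation.ReflTransGen.refl⟩⟩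
  have hsub : G.muct Y ⊆ H.verts := muct_subset hfull
  refine ⟨hsub, ?_, ?_, ?_⟩
  · simp only [muct, Finset.mem_filter]
    exact ⟨hY, fun T hT => hT.2.1⟩
  · ext v
    constructor
    · intro hv
      simp only [descendants, Finset.mem_filter] at hv
      obtain ⟨hvH, s, hs, hsv⟩ := hv
      simp only [muct, Finset.mem_filter]
      refine ⟨hHG hvH, fun T hT => ?_⟩
      rw [← hT.2.2.1]
      simp only [descendants, Finset.mem_filter]
      exact ⟨hvH, s, muct_subset hT hs, hsv⟩
    · intro hv
      simp only [descendants, Finset.mem_filter]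
      exact ⟨hsub hv, v, hv, Relation.ReflTransGen.refl⟩
  · ext v
    constructor
    · intro hv
      simp only [cComponents, Finset.mem_filter] at hv
      obtain ⟨hvH, s, hs, hsv⟩ := hv
      simp only [muct, Finset.mem_filter]
      refine ⟨hHG hvH, fun T hT => ?_⟩
      rw [← hT.2.2.2]
      simp only [cComponents, Finset.mem_filter]
      exact ⟨hvH, s, muct_subset hT hs, hsv⟩
    · intro hv
      simp only [cComponents, Finset.mem_filter]
      exact ⟨hsub hv, v, hv, Relation.ReflTransGen.refl⟩

/-- `muct` is the unique minimal UC-territory. -/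
lemma eq_muct_iff_minimal (G : CausalDiagram V) {Y : V} (hY : Y ∈ G.verts) (T : Finset V) :
    T = G.muct Y ↔ Minimal (G.IsUCTerritory Y) T := by
  constructor
  · rintro rfl
    exact ⟨G.muct_isUCTerritory hY, fun S hS _ => muct_subset hS⟩
  · intro h
    exact le_antisymm (h.2 (G.muct_isUCTerritory hY) (muct_subset h.1)) (muct_subset h.1)

/-- `l` lists the vertices of `G`, each once, parents before their children. -/
def IsTopologicalSort (G : CausalDiagram V) (l : List V) : Prop :=
  l.Nodup ∧ (∀ v, v ∈ l ↔ v ∈ G.verts) ∧ l.Pairwise fun a b => ¬ G.dir b a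

/-- The family `{R | X ⊆ R ⊆ An(T)_G \ T}`. -/
noncomputable def between (G : CausalDiagram V) (X T : Finset V) : Finset (Finset V) :=
  Finset.univ.filter fun R => X ⊆ R ∧ R ⊆ G.ancestors T \ T

/-- The recursive procedure, run on a current diagram `H`, a list `π` and a set `O`, for the input
diagram `G`. The `for` loop over the entries `π[i]` of `π` is unrolled along the list: the first
entry `p` is treated with `π' = π[i+1:]` and `O' = O`, and the remaining iterations of the same loop
are those over the tail of `π` with `p` added to `O` (so that `O' = O ∪ π[1:i-1]` at the `i`-th
iteration of the loop). -/
noncomputable def subPOISs (G : CausalDiagram V) (Y : V) :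
    CausalDiagram V → List V → Finset V → Finset (Finset V)
  | _, [], _ => ∅
  | H, p :: π', O =>
    let T := (H.cutIncoming {p}).muct Y
    let X := (H.cutIncoming {p}).interventionalBorder Y
    (if X ∩ O = ∅ then
        G.between X T ∪
          (if π' ≠ [] then subPOISs G Y ((H.cutIncoming X).induce (T ∪ X)) π' O else ∅)
      else ∅) ∪
    subPOISs G Y H π' (O ∪ {p})

/-- The diagram `Q = G_{\overline X}[T ∪ X]` with `T = MUCT(G, Y)` and `X = IB(G, Y)`, on which the
enumeration starts. -/
noncomputable def startDiagram (G : CausalDiagram V) (Y : V) : CausalDiagram V :=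
  (G.cutIncoming (G.interventionalBorder Y)).induce (G.muct Y ∪ G.interventionalBorder Y)

/-- The enumeration algorithm, run with the topological sort `l` of `Q`. The reward variable, which
cannot be intervened on, is left out of the list of candidate vertices. -/
noncomputable def POISs (G : CausalDiagram V) (Y : V) (l : List V) : Finset (Finset V) :=
  G.between (G.interventionalBorder Y) (G.muct Y) ∪
    G.subPOISs Y (G.startDiagram Y) (l.reverse.filter (· ≠ Y)) ∅

end CausalDiagram

/-- A (recursive) structural causal model with endogenous variables `V`, each with a finite discrete
domain, and a real-valued reward variable `Y`. The exogenous variables are mutually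
independent, of arbitrary law; `scope j` is the set of endogenous variables whose structural function
takes the exogenous variable `j` as an argument. -/
structure SCM (V : Type u) (Y : V) where
  Dom : V → Type
  [domFintype : ∀ v, Fintype (Dom v)]
  [domNonempty : ∀ v, Nonempty (Dom v)]
  /-- the real number that a value of `Y` stands for -/
  value : Dom Y ↪ ℝ
  J : Type u
  [exoFintype : Fintype J]
  U : J → Type
  [exoMeasurableSpace : ∀ j, MeasurableSpace (U j)]
  P : ∀ j, Measure (U j)
  [exoProb : ∀ j, IsProbabilityMeasure (P j)]
  pa : V → Finset V
  wf : WellFounded fun a b => a ∈ pa b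
  scope : J → Finset V
  f : ∀ v, (∀ p : {p // p ∈ pa v}, Dom p) → (∀ j : {j // v ∈ scope j}, U j) → Dom v
  f_meas : ∀ v c d, MeasurableSet {e | f v c e = d}

namespace SCM

variable {V : Type u} [DecidableEq V] {Y : V}

attribute [instance] SCM.domFintype SCM.domNonempty SCM.exoFintype SCM.exoMeasurableSpace
  SCM.exoProb

/-- The causal diagram of the model is `G`: `a → b` if and only if `a` is an argument of the function
of `b`, and `a ↔ b` if and only if `a ≠ b` share an exogenous variable. -/
def Conforms (M : SCM V Y) (G : CausalDiagram V) : Prop :=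
  (∀ a b, G.dir a b ↔ a ∈ M.pa b) ∧
    ∀ a b, G.bi a b ↔ a ≠ b ∧ ∃ j, a ∈ M.scope j ∧ b ∈ M.scope j

/-- The values of the endogenous variables under the intervention `do(X = x[X])` when the exogenous
variables take the values `e`. -/
noncomputable def solve (M : SCM V Y) (X : Finset V) (x : ∀ v, M.Dom v) (e : ∀ j, M.U j) :
    ∀ v, M.Dom v :=
  M.wf.fix fun v ih =>
    if v ∈ X then x v else M.f v (fun p => ih p.1 p.2) (fun j => e j.1)

/-- The expected reward of `do(X = x[X])`; only the coordinates of `x` in `X` matter. -/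
noncomputable def expectedReward (M : SCM V Y) (X : Finset V) (x : ∀ v, M.Dom v) : ℝ :=
  ∫ e, M.value (M.solve X x e Y) ∂(Measure.pi M.P)

/-- The largest expected reward of an intervention on `X` (a maximum over finitely many values). -/
noncomputable def bestReward (M : SCM V Y) (X : Finset V) : ℝ :=
  ⨆ x : ∀ v, M.Dom v, M.expectedReward X x

lemma solve_eq (M : SCM V Y) (X : Finset V) (x : ∀ v, M.Dom v) (e : ∀ j, M.U j) (v : V) :
    M.solve X x e v =
      if v ∈ X then x v else M.f v (fun p => M.solve X x e p.1) (fun j => e j.1) := by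
  rw [solve, WellFounded.fix_eq]

lemma measurableSet_solve (M : SCM V Y) (X : Finset V) (x : ∀ v, M.Dom v) (v : V) :
    ∀ d, MeasurableSet {e | M.solve X x e v = d} := by
  classical
  induction v using M.wf.induction with
  | _ v ih =>
    intro d
    by_cases hv : v ∈ X
    · simp [solve_eq, hv]
    · have : {e | M.solve X x e v = d} =
          ⋃ c : ∀ p : {p // p ∈ M.pa v}, M.Dom p,
            (⋂ p : {p // p ∈ M.pa v}, {e | M.solve X x e p.1 = c p}) ∩
              (fun e (j : {j // v ∈ M.scope j}) => e j.1) ⁻¹' {e | M.f v c e = d} := by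
        ext e
        rw [Set.mem_ofPred_eq, solve_eq, if_neg hv]
        simp only [Set.mem_iUnion, Set.mem_inter_iff, Set.mem_iInter, Set.mem_ofPred_eq,
          Set.mem_preimage]
        constructor
        · intro h
          exact ⟨fun p => M.solve X x e p.1, fun _ => rfl, h⟩
        · rintro ⟨c, hc, h⟩
          have hc' : c = fun p : {p // p ∈ M.pa v} => M.solve X x e p.1 :=
            funext fun p => (hc p).symm
          rwa [hc'] at h
      rw [this]
      refine MeasurableSet.iUnion fun c => (MeasurableSet.iInter fun (p : {p // p ∈ M.pa v}) => ih p.1 p.2 _).inter ?_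
      exact (measurable_pi_lambda _ fun j => measurable_pi_apply j.1) (M.f_meas v c d)

/-- The expected reward is a genuine expectation. -/
lemma integrable_reward (M : SCM V Y) (X : Finset V) (x : ∀ v, M.Dom v) :
    Integrable (fun e => M.value (M.solve X x e Y)) (Measure.pi M.P) := by
  let _ : MeasurableSpace (M.Dom Y) := ⊤
  have hm : Measurable fun e => M.solve X x e Y :=
    measurable_to_countable' fun d => M.measurableSet_solve X x Y d
  obtain ⟨C, hC⟩ := (Set.finite_range fun d : M.Dom Y => ‖M.value d‖).bddAbove
  refine Integrable.of_bound
    ((measurable_from_top (f := M.value)).comp hm).aestronglyMeasurable C ?_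
  exact Filter.Eventually.of_forall fun e => hC ⟨M.solve X x e Y, rfl⟩

end SCM

section Bandit

variable {V : Type u} [Fintype V] [DecidableEq V]

/-- `R` and `W` are equivalent in terms of expected reward: in every model that conforms to `G`, every
joint assignment `x` gives `E_{x[R]} Y = E_{x[W]} Y`. -/
def RewardEquivalent (G : CausalDiagram V) (Y : V) (R W : Finset V) : Prop :=
  ∀ M : SCM V Y, M.Conforms G → ∀ x, M.expectedReward R x = M.expectedReward W x

/-- `R` is a possibly-optimal intervention set: a set of proper ancestors of `Y` such that, in some
model that conforms to `G`, intervening on `R` is strictly better at best than intervening on any set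
`W ⊆ V \ {Y}` that is not equivalent to `R`. -/
def IsPOIS (G : CausalDiagram V) (Y : V) (R : Finset V) : Prop :=
  R ⊆ G.ancestors {Y} \ {Y} ∧
    ∃ M : SCM V Y, M.Conforms G ∧
      ∀ W : Finset V, Y ∉ W → ¬ RewardEquivalent G Y R W → M.bestReward W < M.bestReward R

end Bandit

set_option linter.unusedSectionVars false

open Relation

/-! Both sides are compared with one description. Call `T` a territory if it is generated from `Y`
inside `T` by children and bidirected neighbours, and all its vertices reach `Y` inside `T`. The
sets in question are exactly the `R` with `G.border T ⊆ R ⊆ An(T) \ T` for some territory `T`.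

Algorithm (`mem_POISs_iff`): each diagram it visits has exactly the edges of `G` with arrowheads in
some set `A` (`IsCutTo`), and its MUCT is the largest territory inside `A`, so only such families
are output. Conversely, a given territory is reached by cutting its border vertices one at a time,
in the order of the list; the test against `O` never blocks this route.

POISs (`isPOIS_iff`): let `T` be the MUCT after cutting the arrows into `R`. Conditioning on the
exogenous variables that do not act on `T` shows that the border of `T` does at least as well as `R`
(`bestReward_le_border`). Hence a POIS is equivalent to that border, and a deterministic model then
forces the border into `R`. Conversely, `exists_model` relays fair coins through a territory: `Y`
gets its good value surely when the border is set and `T` is left alone, while any other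
intervention makes the information reaching `Y` inconsistent with positive probability. Sets that
share the first property are equivalent to `R`. -/

namespace CausalDiagram

variable {V : Type u} [Fintype V] [DecidableEq V]

/-! ### Closure properties of the MUCT -/

section Muct

variable {G : CausalDiagram V} {Y : V}

lemma induce_ancestors_dir {a b : V} :
    (G.induce (G.ancestors {Y})).dir a b ↔ G.dir a b ∧ ReflTransGen G.dir b Y := by
  simp only [induce, ancestors, Finset.mem_filter, Finset.mem_singleton, exists_eq_left]
  exact ⟨fun h => ⟨h.1, h.2.2.2⟩, fun h =>
    ⟨h.1, ⟨(G.dir_mem a b h.1).1, h.2.head h.1⟩, (G.dir_mem a b h.1).2, h.2⟩⟩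

lemma induce_ancestors_bi {a b : V} :
    (G.induce (G.ancestors {Y})).bi a b ↔
      G.bi a b ∧ ReflTransGen G.dir a Y ∧ ReflTransGen G.dir b Y := by
  simp only [induce, ancestors, Finset.mem_filter, Finset.mem_singleton, exists_eq_left]
  exact ⟨fun h => ⟨h.1, h.2.1.2, h.2.2.2⟩, fun h =>
    ⟨h.1, ⟨(G.bi_mem a b h.1).1, h.2.1⟩, (G.bi_mem a b h.1).2, h.2.2⟩⟩

lemma mem_induce_ancestors {a : V} :
    a ∈ (G.induce (G.ancestors {Y})).verts ↔ a ∈ G.verts ∧ ReflTransGen G.dir a Y := by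
  simp [induce, ancestors]

lemma mem_muct_self (hY : Y ∈ G.verts) : Y ∈ G.muct Y :=
  (G.muct_isUCTerritory hY).2.1

lemma reflTransGen_of_mem_muct (hY : Y ∈ G.verts) {v : V} (hv : v ∈ G.muct Y) :
    ReflTransGen G.dir v Y :=
  (mem_induce_ancestors.1 ((G.muct_isUCTerritory hY).1 hv)).2

lemma mem_muct_of_dir (hY : Y ∈ G.verts) {v w : V} (hv : v ∈ G.muct Y) (h : G.dir v w)
    (hw : ReflTransGen G.dir w Y) : w ∈ G.muct Y := by
  rw [← (G.muct_isUCTerritory hY).2.2.1]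
  simp only [descendants, Finset.mem_filter]
  exact ⟨mem_induce_ancestors.2 ⟨(G.dir_mem _ _ h).2, hw⟩, v, hv,
    ReflTransGen.single (induce_ancestors_dir.2 ⟨h, hw⟩)⟩

lemma mem_muct_of_bi (hY : Y ∈ G.verts) {v w : V} (hv : v ∈ G.muct Y) (h : G.bi v w)
    (hw : ReflTransGen G.dir w Y) : w ∈ G.muct Y := by
  rw [← (G.muct_isUCTerritory hY).2.2.2]
  simp only [cComponents, Finset.mem_filter]
  exact ⟨mem_induce_ancestors.2 ⟨(G.bi_mem _ _ h).2, hw⟩, v, hv,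
    ReflTransGen.single (induce_ancestors_bi.2 ⟨h, reflTransGen_of_mem_muct hY hv, hw⟩)⟩

/-- The vertices of the MUCT that satisfy `P` form a UC-territory, so by minimality they are all of
it. -/
lemma muct_induction (hY : Y ∈ G.verts) {P : V → Prop} (h0 : P Y)
    (hdir : ∀ v w, v ∈ G.muct Y → P v → G.dir v w → w ∈ G.muct Y → P w)
    (hbi : ∀ v w, v ∈ G.muct Y → P v → G.bi v w → w ∈ G.muct Y → P w)
    {v : V} (hv : v ∈ G.muct Y) : P v := by
  classical
  have hT : G.IsUCTerritory Y ((G.muct Y).filter P) := by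
    refine ⟨(Finset.filter_subset _ _).trans (G.muct_isUCTerritory hY).1,
      Finset.mem_filter.2 ⟨mem_muct_self hY, h0⟩, ?_, ?_⟩
    · ext w
      simp only [descendants, Finset.mem_filter]
      constructor
      · rintro ⟨-, s, hs, hsw⟩
        induction hsw with
        | refl => exact hs
        | tail _ h ih =>
          rw [induce_ancestors_dir] at h
          have := mem_muct_of_dir hY ih.1 h.1 h.2
          exact ⟨this, hdir _ _ ih.1 ih.2 h.1 this⟩
      · intro h
        exact ⟨(G.muct_isUCTerritory hY).1 h.1, w, h, ReflTransGen.refl⟩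
    · ext w
      simp only [cComponents, Finset.mem_filter]
      constructor
      · rintro ⟨-, s, hs, hsw⟩
        induction hsw with
        | refl => exact hs
        | tail _ h ih =>
          rw [induce_ancestors_bi] at h
          have := mem_muct_of_bi hY ih.1 h.1 h.2.2
          exact ⟨this, hbi _ _ ih.1 ih.2 h.1 this⟩
      · intro h
        exact ⟨(G.muct_isUCTerritory hY).1 h.1, w, h, ReflTransGen.refl⟩
  exact (Finset.mem_filter.1 (muct_subset hT hv)).2

end Muct

/-! ### Territories and their borders -/

/-- `T` is its own minimal UC-territory in `G[T]`: all its vertices are ancestors of `Y` inside `T`,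
and no smaller set containing `Y` is closed inside `T` under children and bidirected neighbours. -/
structure IsTerritory (G : CausalDiagram V) (Y : V) (T : Finset V) : Prop where
  mem : Y ∈ T
  path : ∀ v ∈ T, ReflTransGen (fun a b => G.dir a b ∧ b ∈ T) v Y
  minimal : ∀ P : V → Prop, P Y → (∀ v ∈ T, P v → ∀ w ∈ T, G.dir v w → P w) →
    (∀ v ∈ T, P v → ∀ w ∈ T, G.bi v w → P w) → ∀ v ∈ T, P v

/-- The vertices outside `T` with a child in `T`. -/
noncomputable def border (G : CausalDiagram V) (T : Finset V) : Finset V := G.parents T \ T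

variable {G : CausalDiagram V} {Y : V} {A T : Finset V}

lemma mem_border {v : V} : v ∈ G.border T ↔ v ∉ T ∧ ∃ t ∈ T, G.dir v t := by
  simp only [border, parents, Finset.mem_sdiff, Finset.mem_filter]
  exact ⟨fun h => ⟨h.2, h.1.2⟩, fun ⟨h, t, ht, hd⟩ => ⟨⟨(G.dir_mem _ _ hd).1, t, ht, hd⟩, h⟩⟩

/-- A path that leads into `T` either starts in `T` or passes through the border of `T`. -/
lemma exists_border_of_path {r : V → V → Prop} (hr : ∀ a b, r a b → G.dir a b) {v t : V}
    (h : ReflTransGen r v t) (ht : t ∈ T) (hv : v ∉ T) :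
    ∃ x ∈ G.border T, ReflTransGen r v x := by
  induction h using ReflTransGen.head_induction_on with
  | refl => exact absurd ht hv
  | @head a c hac _ ih =>
    by_cases hc : c ∈ T
    · exact ⟨a, mem_border.2 ⟨hv, c, hc, hr _ _ hac⟩, ReflTransGen.refl⟩
    · obtain ⟨x, hx, hcx⟩ := ih hc
      exact ⟨x, hx, hcx.head hac⟩

lemma mem_of_path {T : Finset V} {v w : V}
    (h : ReflTransGen (fun a b => G.dir a b ∧ b ∈ T) v w) (hv : v ∈ T) : w ∈ T := by
  induction h with
  | refl => exact hv
  | tail _ h _ => exact h.2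

namespace IsTerritory

/-- A path inside `S` from a vertex outside `T` to `Y` would have to cross the border of `T`. -/
lemma subset_of_disjoint_border {S : Finset V} (hS : G.IsTerritory Y S) (hY : Y ∈ T)
    (h : Disjoint (G.border T) S) : S ⊆ T := by
  intro v hv
  by_contra hvT
  obtain ⟨x, hx, hvx⟩ := exists_border_of_path (fun _ _ h => h.1) (hS.path v hv) hY hvT
  exact Finset.disjoint_left.1 h hx (mem_of_path hvx hv)

end IsTerritory

/-! ### Diagrams obtained by cutting arrowheads -/

/-- `H` has exactly the edges of `G` whose arrowheads are in `A`. -/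
structure IsCutTo (G : CausalDiagram V) (Y : V) (A : Finset V) (H : CausalDiagram V) : Prop where
  mem : Y ∈ A
  mem_verts : Y ∈ H.verts
  dir_iff : ∀ a b, H.dir a b ↔ G.dir a b ∧ b ∈ A
  bi_iff : ∀ a b, H.bi a b ↔ G.bi a b ∧ a ∈ A ∧ b ∈ A

namespace IsCutTo

variable {H : CausalDiagram V}

lemma muct_subset (h : G.IsCutTo Y A H) : H.muct Y ⊆ A := by
  intro v hv
  refine muct_induction (P := fun v => v ∈ A) h.mem_verts h.mem ?_ ?_ hv
  · intro v w _ _ hvw _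
    exact ((h.dir_iff _ _).1 hvw).2
  · intro v w _ _ hvw _
    exact ((h.bi_iff _ _).1 hvw).2.2

lemma isTerritory_muct (h : G.IsCutTo Y A H) : G.IsTerritory Y (H.muct Y) where
  mem := mem_muct_self h.mem_verts
  path v hv := by
    have hp := reflTransGen_of_mem_muct h.mem_verts hv
    induction hp using ReflTransGen.head_induction_on with
    | refl => exact ReflTransGen.refl
    | head hac hcY ih =>
      have hc := mem_muct_of_dir h.mem_verts hv hac hcY
      exact (ih hc).head ⟨((h.dir_iff _ _).1 hac).1, hc⟩
  minimal P h0 hdir hbi v hv := by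
    refine muct_induction h.mem_verts h0 ?_ ?_ hv
    · intro v w hv hP hvw hw
      exact hdir v hv hP w hw ((h.dir_iff _ _).1 hvw).1
    · intro v w hv hP hvw hw
      exact hbi v hv hP w hw ((h.bi_iff _ _).1 hvw).1

/-- Paths inside `T` survive in `H`, so the closure of the MUCT follows the generation of `T` from
`Y`. With `muct_subset` and `isTerritory_muct`, this makes the MUCT the largest territory inside
`A`. -/
lemma subset_muct (h : G.IsCutTo Y A H) (hT : G.IsTerritory Y T) (hTA : T ⊆ A) :
    T ⊆ H.muct Y := by
  have hpath : ∀ v ∈ T, ReflTransGen H.dir v Y := fun v hv =>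
    ReflTransGen.mono (fun a b hab => (h.dir_iff a b).2 ⟨hab.1, hTA hab.2⟩) _ _ (hT.path v hv)
  refine hT.minimal _ (mem_muct_self h.mem_verts) ?_ ?_
  · intro v _ hv w hw hvw
    exact mem_muct_of_dir h.mem_verts hv ((h.dir_iff _ _).2 ⟨hvw, hTA hw⟩) (hpath w hw)
  · intro v hvT hv w hw hvw
    exact mem_muct_of_bi h.mem_verts hv ((h.bi_iff _ _).2 ⟨hvw, hTA hvT, hTA hw⟩) (hpath w hw)

/-- No arrow of `G` into the MUCT has been cut, so the border can be read off in `G`. -/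
lemma interventionalBorder_eq (h : G.IsCutTo Y A H) :
    H.interventionalBorder Y = G.border (H.muct Y) := by
  ext v
  simp only [mem_border, interventionalBorder, parents, Finset.mem_sdiff, Finset.mem_filter,
    h.dir_iff]
  constructor
  · rintro ⟨⟨-, t, ht, hd⟩, hv⟩
    exact ⟨hv, t, ht, hd.1⟩
  · rintro ⟨hv, t, ht, hd⟩
    have : H.dir v t := (h.dir_iff _ _).2 ⟨hd, h.muct_subset ht⟩
    exact ⟨⟨(H.dir_mem _ _ this).1, t, ht, hd, h.muct_subset ht⟩, hv⟩

lemma cutIncoming_singleton (h : G.IsCutTo Y A H) {p : V} (hp : p ≠ Y) :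
    G.IsCutTo Y (A.erase p) (H.cutIncoming {p}) where
  mem := Finset.mem_erase.2 ⟨hp.symm, h.mem⟩
  mem_verts := h.mem_verts
  dir_iff a b := by
    simp only [cutIncoming, h.dir_iff, Finset.mem_singleton, Finset.mem_erase]
    tauto
  bi_iff a b := by
    simp only [cutIncoming, h.bi_iff, Finset.mem_singleton, Finset.mem_erase]
    tauto

lemma induce_border (h : G.IsCutTo Y A H) (hY : Y ∈ T) (hTA : T ⊆ A) :
    G.IsCutTo Y T ((H.cutIncoming (G.border T)).induce (T ∪ G.border T)) where
  mem := hY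
  mem_verts := by
    simp [induce, cutIncoming, h.mem_verts, hY]
  dir_iff a b := by
    simp only [induce, cutIncoming, h.dir_iff, Finset.mem_union]
    constructor
    · rintro ⟨⟨⟨hd, -⟩, hb⟩, -, hb'⟩
      exact ⟨hd, hb'.resolve_right hb⟩
    · rintro ⟨hd, hb⟩
      refine ⟨⟨⟨hd, hTA hb⟩, fun hb' => (mem_border.1 hb').1 hb⟩, ?_, Or.inl hb⟩
      by_cases ha : a ∈ T
      · exact Or.inl ha
      · exact Or.inr (mem_border.2 ⟨ha, b, hb, hd⟩)
  bi_iff a b := by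
    simp only [induce, cutIncoming, h.bi_iff, Finset.mem_union]
    constructor
    · rintro ⟨⟨⟨hd, -⟩, ha, hb⟩, ha', hb'⟩
      exact ⟨hd, ha'.resolve_right ha, hb'.resolve_right hb⟩
    · rintro ⟨hd, ha, hb⟩
      exact ⟨⟨⟨hd, hTA ha, hTA hb⟩, fun ha' => (mem_border.1 ha').1 ha,
        fun hb' => (mem_border.1 hb').1 hb⟩, Or.inl ha, Or.inl hb⟩

end IsCutTo

lemma isCutTo_cutIncoming (hY : Y ∈ G.verts) {R : Finset V} (hR : Y ∉ R) :
    G.IsCutTo Y Rᶜ (G.cutIncoming R) where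
  mem := by simpa using hR
  mem_verts := hY
  dir_iff a b := by simp [cutIncoming]
  bi_iff a b := by simp [cutIncoming]

lemma isCutTo_self (hY : Y ∈ G.verts) : G.IsCutTo Y Finset.univ G where
  mem := by simp
  mem_verts := hY
  dir_iff a b := by simp
  bi_iff a b := by simp

lemma IsTerritory.ancestors_eq (hT : G.IsTerritory Y T) : G.ancestors T = G.ancestors {Y} := by
  ext v
  simp only [ancestors, Finset.mem_filter, Finset.mem_singleton, exists_eq_left]
  refine and_congr_right fun _ => ⟨?_, fun h => ⟨Y, hT.mem, h⟩⟩
  rintro ⟨t, ht, hvt⟩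
  exact hvt.trans (ReflTransGen.mono (fun _ _ h => h.1) _ _ (hT.path t ht))

/-! ### Topological sorts -/

lemma exists_isTopologicalSort (H : CausalDiagram V) : ∃ l : List V, H.IsTopologicalSort l := by
  classical
  -- The number of ancestors increases strictly along every edge, so sorting by it is topological.
  let rank : V → ℕ := fun v => (Finset.univ.filter fun a => ReflTransGen H.dir a v).card
  have hrank : ∀ a b, H.dir a b → rank a < rank b := by
    intro a b hab
    refine Finset.card_lt_card ⟨?_, ?_⟩
    · intro c hc
      simp only [Finset.mem_filter, Finset.mem_univ, true_and] at hc ⊢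
      exact hc.tail hab
    · intro hsub
      have := hsub (Finset.mem_filter.2 ⟨Finset.mem_univ b, ReflTransGen.refl⟩)
      simp only [Finset.mem_filter, Finset.mem_univ, true_and] at this
      exact H.acyclic a (TransGen.head' hab this)
  let r : V → V → Prop := fun a b => rank a ≤ rank b
  have : Std.Total r := ⟨fun a b => le_total (rank a) (rank b)⟩
  have : IsTrans V r := ⟨fun a b c => le_trans (a := rank a)⟩
  refine ⟨H.verts.toList.insertionSort r, ?_, ?_, ?_⟩
  · exact (List.perm_insertionSort r _).nodup_iff.2 (Finset.nodup_toList _)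
  · intro v
    simp
  · exact (List.pairwise_insertionSort r _).imp fun {a b} hab hba =>
      (hrank b a hba).not_ge hab

lemma IsTopologicalSort.idxOf_lt {H : CausalDiagram V} {l : List V} (hl : H.IsTopologicalSort l)
    {a b : V} (h : TransGen H.dir a b) : l.idxOf a < l.idxOf b := by
  have key : ∀ a b, H.dir a b → l.idxOf a < l.idxOf b := by
    intro a b hab
    have ha := List.idxOf_lt_length_of_mem ((hl.2.1 a).2 (H.dir_mem a b hab).1)
    have hb := List.idxOf_lt_length_of_mem ((hl.2.1 b).2 (H.dir_mem a b hab).2)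
    by_contra! hle
    rcases hle.lt_or_eq with hlt | heq
    · have := List.pairwise_iff_getElem.1 hl.2.2 _ _ hb ha hlt
      rw [List.getElem_idxOf hb, List.getElem_idxOf ha] at this
      exact this hab
    · have : a = b := by
        rw [← List.getElem_idxOf ha, ← List.getElem_idxOf hb]
        simp only [heq]
      subst this
      exact H.acyclic a (TransGen.single hab)
  induction h with
  | single h => exact key _ _ h
  | tail _ h ih => exact ih.trans (key _ _ h)

lemma IsTopologicalSort.pairwise_reverse {H : CausalDiagram V} {l : List V}
    (hl : H.IsTopologicalSort l) : l.reverse.Pairwise fun a b => ¬ TransGen H.dir a b := by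
  rw [List.pairwise_reverse, List.pairwise_iff_getElem]
  intro i j hi hj hij h
  have := hl.idxOf_lt h
  rw [hl.1.idxOf_getElem, hl.1.idxOf_getElem] at this
  omega

/-! ### The output of the enumeration -/

lemma mem_between {X T R : Finset V} : R ∈ G.between X T ↔ X ⊆ R ∧ R ⊆ G.ancestors T \ T := by
  simp [between]

lemma exists_isTerritory_of_mem_subPOISs {R : Finset V} (π : List V) :
    ∀ (H : CausalDiagram V) (A O : Finset V), G.IsCutTo Y A H → Y ∉ π →
      R ∈ G.subPOISs Y H π O → ∃ T, G.IsTerritory Y T ∧ R ∈ G.between (G.border T) T := by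
  induction π with
  | nil =>
    intro H A O _ _ h
    simp [subPOISs] at h
  | cons p π ih =>
    intro H A O hH hY h
    rw [List.mem_cons, not_or] at hY
    have hp := hH.cutIncoming_singleton (Ne.symm hY.1)
    simp only [subPOISs, hp.interventionalBorder_eq, Finset.mem_union] at h
    rcases h with h | h
    · split_ifs at h with h1 h2
      · rcases Finset.mem_union.1 h with h | h
        · exact ⟨_, hp.isTerritory_muct, h⟩
        · exact ih _ _ _ (hH.induce_border hp.isTerritory_muct.mem
            (hp.muct_subset.trans (Finset.erase_subset _ _))) hY.2 h
      · simp only [Finset.union_empty] at h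
        exact ⟨_, hp.isTerritory_muct, h⟩
      · simp at h
    · exact ih _ _ _ hH hY.2 h

/-- The enumeration reaches every territory inside the current one whose border has a vertex among
those still to be treated. -/
lemma between_subset_subPOISs {r : V → V → Prop} {S : Finset V} (hS : G.IsTerritory Y S)
    (π : List V) :
    ∀ (H : CausalDiagram V) (A O : Finset V), G.IsCutTo Y A H → Y ∉ π → S ⊆ A →
      (∀ a b, G.dir a b → b ∈ A → r a b) → (π.Pairwise fun a b => ¬ TransGen r a b) →
      (∀ o ∈ O, ∀ a ∈ π, ¬ TransGen r o a) → (∀ o ∈ O, o ∉ G.border S) →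
      (∀ x ∈ G.border S, x ∈ A → x ∈ π) → (∃ x ∈ G.border S, x ∈ π) →
      G.between (G.border S) S ⊆ G.subPOISs Y H π O := by
  induction π with
  | nil =>
    intro H A O _ _ _ _ _ _ _ _ ⟨x, _, hx⟩
    simp at hx
  | cons p π ih =>
    intro H A O hH hY hSA hr hπ hOπ hO hAπ hex
    rw [List.mem_cons, not_or] at hY
    rw [List.pairwise_cons] at hπ
    have hp := hH.cutIncoming_singleton (Ne.symm hY.1)
    simp only [subPOISs, hp.interventionalBorder_eq]
    by_cases hpS : p ∈ G.border S
    · refine subset_trans ?_ Finset.subset_union_left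
      have hT := hp.isTerritory_muct
      have hTA := hp.muct_subset.trans (Finset.erase_subset _ _)
      have hpT : p ∉ (H.cutIncoming {p}).muct Y := fun h =>
        Finset.notMem_erase p A (hp.muct_subset h)
      have hST := hp.subset_muct hS fun s hs => Finset.mem_erase.2
        ⟨fun h => (mem_border.1 hpS).1 (h ▸ hs), hSA hs⟩
      set T := (H.cutIncoming {p}).muct Y
      have hmem : ∀ x ∈ G.border S, x ∈ T → x ∈ π := fun x hx hxT =>
        (List.mem_cons.1 (hAπ x hx (hTA hxT))).resolve_left fun h => hpT (h ▸ hxT)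
      -- A vertex `q` of `O` in the border of `T` has its child in `T` outside `S`. The path from
      -- that child to `Y` enters `S` through a border vertex still in `π`, which would make `q` an
      -- ancestor of an entry of `π`.
      have hTO : G.border T ∩ O = ∅ := by
        rw [Finset.eq_empty_iff_forall_notMem]
        intro q hq
        rw [Finset.mem_inter, mem_border] at hq
        obtain ⟨⟨hqT, t, htT, hqt⟩, hqO⟩ := hq
        have htS : t ∉ S := fun htS =>
          hO q hqO (mem_border.2 ⟨fun h => hqT (hST h), t, htS, hqt⟩)
        obtain ⟨x, hx, htx⟩ :=
          exists_border_of_path (fun _ _ h => h.1) (hT.path t htT) hS.mem htS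
        refine hOπ q hqO x (List.mem_cons_of_mem _ (hmem x hx (mem_of_path htx htT))) ?_
        exact TransGen.head' (hr q t hqt (hTA htT))
          (ReflTransGen.mono (fun a b hab => hr a b hab.1 (hTA hab.2)) _ _ htx)
      rw [if_pos hTO]
      -- Either nothing of the border of `S` is left in `T`, and `T = S`, or a border vertex remains
      -- to be cut by the recursive call.
      by_cases hTS : Disjoint (G.border S) T
      · rw [hST.antisymm (hT.subset_of_disjoint_border hS.mem hTS)]
        exact Finset.subset_union_left
      · obtain ⟨x, hx, hxT⟩ := Finset.not_disjoint_iff.1 hTS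
        have hxπ := hmem x hx hxT
        rw [if_pos (List.ne_nil_of_mem hxπ)]
        refine subset_trans (ih _ _ _ (hH.induce_border hT.mem hTA) hY.2 hST
          (fun a b hab hb => hr a b hab (hTA hb)) hπ.2
          (fun o ho a ha => hOπ o ho a (List.mem_cons_of_mem _ ha)) hO hmem ⟨x, hx, hxπ⟩)
          Finset.subset_union_right
    · have hne : ∀ x ∈ G.border S, x ∈ p :: π → x ∈ π := fun x hx hxπ =>
        (List.mem_cons.1 hxπ).resolve_left fun h => hpS (h ▸ hx)
      refine subset_trans (ih _ _ _ hH hY.2 hSA hr hπ.2 ?_ ?_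
        (fun x hx hxA => hne x hx (hAπ x hx hxA)) ?_) Finset.subset_union_right
      · intro o ho a ha
        rcases Finset.mem_union.1 ho with ho | ho
        · exact hOπ o ho a (List.mem_cons_of_mem _ ha)
        · exact Finset.mem_singleton.1 ho ▸ hπ.1 a ha
      · intro o ho
        rcases Finset.mem_union.1 ho with ho | ho
        · exact hO o ho
        · exact Finset.mem_singleton.1 ho ▸ hpS
      · obtain ⟨x, hx, hxπ⟩ := hex
        exact ⟨x, hx, hne x hx hxπ⟩

theorem mem_POISs_iff (hY : Y ∈ G.verts) {l : List V}
    (hl : (G.startDiagram Y).IsTopologicalSort l) (R : Finset V) :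
    R ∈ G.POISs Y l ↔ ∃ T, G.IsTerritory Y T ∧ R ∈ G.between (G.border T) T := by
  have hG := isCutTo_self (G := G) hY
  have hT := hG.isTerritory_muct
  have hQ := hG.induce_border hT.mem hG.muct_subset
  rw [← hG.interventionalBorder_eq] at hQ
  change G.IsCutTo Y (G.muct Y) (G.startDiagram Y) at hQ
  have hYπ : Y ∉ l.reverse.filter (· ≠ Y) := by simp
  rw [POISs, Finset.mem_union]
  constructor
  · rintro (h | h)
    · rw [hG.interventionalBorder_eq] at h
      exact ⟨_, hT, h⟩
    · exact exists_isTerritory_of_mem_subPOISs _ _ _ _ hQ hYπ h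
  · rintro ⟨S, hS, hR⟩
    have hST := hG.subset_muct hS (Finset.subset_univ S)
    by_cases hd : Disjoint (G.border S) (G.muct Y)
    · left
      rwa [hG.interventionalBorder_eq, ← hST.antisymm (hT.subset_of_disjoint_border hS.mem hd)]
    · right
      have hmem : ∀ x ∈ G.border S, x ∈ G.muct Y → x ∈ l.reverse.filter (· ≠ Y) := by
        intro x hx hxT
        have : x ≠ Y := fun h => (mem_border.1 hx).1 (h ▸ hS.mem)
        simp only [List.mem_filter, List.mem_reverse, hl.2.1, decide_eq_true_eq]
        refine ⟨?_, this⟩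
        have hxV : x ∈ G.verts := (mem_border.1 hx).2.elim fun t ht => (G.dir_mem _ _ ht.2).1
        exact Finset.mem_inter.2 ⟨hxV, Finset.mem_union_left _ hxT⟩
      obtain ⟨x, hx, hxT⟩ := Finset.not_disjoint_iff.1 hd
      exact between_subset_subPOISs hS _ _ _ _ hQ hYπ hST
        (fun a b hab hb => (hQ.dir_iff a b).2 ⟨hab, hb⟩) (hl.pairwise_reverse.filter _)
        (by simp) (by simp) hmem ⟨x, hx, hmem x hx hxT⟩ hR

end CausalDiagram

/-! ### Comparing expected rewards -/

namespace SCM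

variable {V : Type u} [Fintype V] [DecidableEq V] {Y : V}

open CausalDiagram

variable {G : CausalDiagram V} {T : Finset V}

/-- On a set that is not intervened on, the values are determined by those on the border and by the
exogenous variables that act on the set. -/
lemma solve_congr (M : SCM V Y) (hM : M.Conforms G) {R W : Finset V} (hR : Disjoint R T)
    (hW : Disjoint W T) {r w : ∀ v, M.Dom v} {e e' : ∀ j, M.U j}
    (hb : ∀ x ∈ G.border T, M.solve R r e x = M.solve W w e' x)
    (he : ∀ j, ∀ t ∈ T, t ∈ M.scope j → e j = e' j) {t : V} (ht : t ∈ T) :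
    M.solve R r e t = M.solve W w e' t := by
  induction t using M.wf.induction with
  | _ t ih =>
    rw [solve_eq, solve_eq M W, if_neg fun h => Finset.disjoint_left.1 hR h ht,
      if_neg fun h => Finset.disjoint_left.1 hW h ht]
    congr 1
    · funext ⟨p, hp⟩
      by_cases hpT : p ∈ T
      · exact ih p hp hpT
      · exact hb p (mem_border.2 ⟨hpT, t, ht, (hM.1 p t).2 hp⟩)
    · funext j
      exact he j t ht j.2

/-- Interventions that contain the border of a set with `Y` and are disjoint from it are
equivalent. -/
lemma rewardEquivalent_of_border_subset (hY : Y ∈ T) {R W : Finset V} (hXR : G.border T ⊆ R)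
    (hXW : G.border T ⊆ W) (hR : Disjoint R T) (hW : Disjoint W T) :
    RewardEquivalent G Y R W := by
  intro M hM x
  unfold expectedReward
  refine integral_congr_ae (Filter.Eventually.of_forall fun e => ?_)
  simp only
  rw [M.solve_congr hM hR hW (r := x) (w := x) (e := e) (e' := e) ?_ (fun _ _ _ _ => rfl) hY]
  intro v hv
  rw [solve_eq, solve_eq M W, if_pos (hXR hv), if_pos (hXW hv)]

lemma bddAbove_expectedReward (M : SCM V Y) (X : Finset V) :
    BddAbove (Set.range fun x => M.expectedReward X x) :=
  (Set.finite_range _).bddAbove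

lemma expectedReward_le_bestReward (M : SCM V Y) (X : Finset V) (x : ∀ v, M.Dom v) :
    M.expectedReward X x ≤ M.bestReward X :=
  le_ciSup (M.bddAbove_expectedReward X) x

section Pi

variable {ι : Type*} [Fintype ι] {α : ι → Type*} [∀ i, MeasurableSpace (α i)]
  (μ : ∀ i, Measure (α i)) [∀ i, IsProbabilityMeasure (μ i)]

/-- If fixing the coordinates outside `p` turns `f` into a function whose integral is at most `c`,
then the integral of `f` is at most `c`. -/
lemma integral_pi_le_of_forall_fix (p : ι → Prop) [DecidablePred p]
    {f : (∀ i, α i) → ℝ} (hf : Integrable f (Measure.pi μ)) {c : ℝ}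
    (h : ∀ a : ∀ i, α i, ∃ g : (∀ i, α i) → ℝ, Integrable g (Measure.pi μ) ∧
      ∫ e, g e ∂Measure.pi μ ≤ c ∧
      (∀ e e', (∀ i, p i → e i = e' i) → g e = g e') ∧
      ∀ e, (∀ i, ¬ p i → e i = a i) → f e = g e) :
    ∫ e, f e ∂Measure.pi μ ≤ c := by
  set φ := MeasurableEquiv.piEquivPiSubtypeProd α p
  have hφ : MeasurePreserving φ.symm
      ((Measure.pi fun i : Subtype p => μ i).prod (Measure.pi fun i : {i // ¬ p i} => μ i))
      (Measure.pi μ) := (measurePreserving_piEquivPiSubtypeProd μ p).symm _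
  have happ : ∀ u v i, φ.symm (u, v) i = if h : p i then u ⟨i, h⟩ else v ⟨i, h⟩ :=
    fun _ _ _ => rfl
  have split : ∀ g : (∀ i, α i) → ℝ, Integrable g (Measure.pi μ) →
      ∫ e, g e ∂Measure.pi μ =
        ∫ v, ∫ u, g (φ.symm (u, v)) ∂(Measure.pi fun i : Subtype p => μ i)
          ∂(Measure.pi fun i : {i // ¬ p i} => μ i) := by
    intro g hg
    rw [← hφ.integral_comp φ.symm.measurableEmbedding]
    exact integral_prod_symm _ (hφ.integrable_comp_of_integrable hg)
  have : ∀ i, Nonempty (α i) := fun i => (μ i).nonempty_of_neZero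
  obtain ⟨a0⟩ : Nonempty (∀ i, α i) := inferInstance
  rw [split f hf]
  have hint := (hφ.integrable_comp_of_integrable hf).integral_prod_right
  calc ∫ v, ∫ u, f (φ.symm (u, v)) ∂(Measure.pi fun i : Subtype p => μ i)
          ∂(Measure.pi fun i : {i // ¬ p i} => μ i)
      ≤ ∫ _, c ∂(Measure.pi fun i : {i // ¬ p i} => μ i) := by
        refine integral_mono hint (integrable_const c) fun v => ?_
        -- Only the coordinates `v` matter here; `a0` fills the others arbitrarily.
        obtain ⟨g, hg, hgc, hgp, hfg⟩ := h (φ.symm (fun i => a0 i, v))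
        rw [split g hg] at hgc
        have h1 : ∀ v' u, g (φ.symm (u, v')) = f (φ.symm (u, v)) := by
          intro v' u
          rw [hfg]
          · refine hgp _ _ fun i hi => ?_
            simp [happ, hi]
          · intro i hi
            simp [happ, hi]
        simp only [h1, integral_const, probReal_univ, smul_eq_mul, one_mul] at hgc
        exact hgc
    _ = c := by simp

end Pi

/-- Intervening on the interventional border is at least as good as intervening on `R`. -/
lemma bestReward_le_border (M : SCM V Y) (hM : M.Conforms G) (hY : Y ∈ G.verts) {R : Finset V}
    (hR : Y ∉ R) :
    M.bestReward R ≤ M.bestReward (G.border ((G.cutIncoming R).muct Y)) := by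
  classical
  have hc := isCutTo_cutIncoming hY hR
  have hYK : Y ∈ (G.cutIncoming R).verts := hY
  set K := G.cutIncoming R
  set T := K.muct Y
  have hYT : Y ∈ T := mem_muct_self hYK
  have hRT : Disjoint R T := Finset.subset_compl_iff_disjoint_left.1 hc.muct_subset
  have hXT : Disjoint (G.border T) T :=
    Finset.disjoint_left.2 fun x hx => (mem_border.1 hx).1
  -- Ancestors of `Y` in `K` outside `T` have no parent in `T` and, unless intervened on, share no
  -- exogenous variable with `T`. So the border values depend only on exogenous variables that do
  -- not act on `T`.
  have hkey : ∀ (r : ∀ v, M.Dom v) (e e' : ∀ j, M.U j),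
      (∀ j, ¬ (∃ t ∈ T, t ∈ M.scope j) → e j = e' j) →
      ∀ a, ReflTransGen K.dir a Y → a ∉ T → M.solve R r e a = M.solve R r e' a := by
    intro r e e' he a
    induction a using M.wf.induction with
    | _ a ih =>
      intro haY haT
      rw [solve_eq, solve_eq M R r e']
      split_ifs with haR
      · rfl
      · congr 1
        · funext ⟨p, hp⟩
          have hpa : K.dir p a := ⟨(hM.1 p a).2 hp, haR⟩
          exact ih p hp (haY.head hpa) fun hpT => haT (mem_muct_of_dir hYK hpT hpa haY)
        · funext j
          refine he j ?_
          rintro ⟨t, ht, htj⟩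
          have hta : K.bi t a := ⟨(hM.2 t a).2 ⟨fun h => haT (h ▸ ht), j, htj, j.2⟩,
            Finset.disjoint_right.1 hRT ht, haR⟩
          exact haT (mem_muct_of_bi hYK ht hta haY)
  have hborder : ∀ x ∈ G.border T, ReflTransGen K.dir x Y ∧ x ∉ T := by
    intro x hx
    obtain ⟨hxT, t, ht, hxt⟩ := mem_border.1 hx
    exact ⟨(reflTransGen_of_mem_muct hYK ht).head ⟨hxt, Finset.disjoint_right.1 hRT ht⟩, hxT⟩
  refine ciSup_le fun r => ?_
  refine integral_pi_le_of_forall_fix M.P (fun j => ∃ t ∈ T, t ∈ M.scope j)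
    (M.integrable_reward R r) fun a => ?_
  -- With the other exogenous variables fixed at `a`, the border takes fixed values under `do(R =
  -- r)`, and setting it to these values gives the same reward.
  refine ⟨fun e => M.value (M.solve (G.border T) (M.solve R r a) e Y),
    M.integrable_reward _ _, M.expectedReward_le_bestReward _ _, ?_, ?_⟩
  · intro e e' he
    simp only
    rw [M.solve_congr hM hXT hXT (e := e) (e' := e') ?_ (fun j t ht htj => he j ⟨t, ht, htj⟩) hYT]
    intro x hx
    rw [solve_eq, solve_eq _ _ _ e', if_pos hx, if_pos hx]
  · intro e he
    simp only
    rw [M.solve_congr hM hRT hXT (e := e) (e' := e) ?_ (fun _ _ _ _ => rfl) hYT]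
    intro x hx
    rw [solve_eq M (G.border T), if_pos hx]
    exact hkey r e a he x (hborder x hx).1 (hborder x hx).2

end SCM

/-! ### Models driven by fair coins -/

namespace CausalDiagram

variable {V : Type u} [Fintype V] [DecidableEq V]

/-- The exogenous variable `j` acts on `v`. -/
def Acts (G : CausalDiagram V) (j : V × V) (v : V) : Prop := G.bi j.1 j.2 ∧ (v = j.1 ∨ v = j.2)

open Classical in
/-- The model on `G` with a fair coin for every bidirected edge, the common domain `D`, and the
structural functions `f`. -/
noncomputable def toSCM (G : CausalDiagram V) (Y : V) {D : Type} [Fintype D] [Nonempty D]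
    (val : D ↪ ℝ)
    (f : ∀ v, ({p // G.dir p v} → D) → ({j // G.Acts j v} → Bool) → D) : SCM V Y where
  Dom _ := D
  value := val
  J := V × V
  U _ := Bool
  P _ := (PMF.uniformOfFintype Bool).toMeasure
  pa v := Finset.univ.filter fun p => G.dir p v
  wf := by
    have : IsTrans V (TransGen G.dir) := inferInstance
    have : Std.Irrefl (TransGen G.dir) := ⟨G.acyclic⟩
    refine Subrelation.wf ?_ (Finite.wellFounded_of_trans_of_irrefl (TransGen G.dir))
    intro a b hab
    exact TransGen.single (by simpa using hab)
  scope j := Finset.univ.filter fun v => G.Acts j v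
  f v c u := f v (fun p => c ⟨p.1, by simpa using p.2⟩) (fun j => u ⟨j.1, by simpa using j.2⟩)
  f_meas _ _ _ := (Set.toFinite _).measurableSet

variable {G : CausalDiagram V} {Y : V}

section Model

variable {D : Type} [Fintype D] [Nonempty D] {val : D ↪ ℝ}
  {f : ∀ v, ({p // G.dir p v} → D) → ({j // G.Acts j v} → Bool) → D}

lemma toSCM_conforms : (G.toSCM Y val f).Conforms G := by
  classical
  refine ⟨fun a b => by simp [toSCM], fun a b => ⟨fun h => ⟨?_, (a, b), ?_, ?_⟩, ?_⟩⟩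
  · rintro rfl
    exact G.bi_irrefl a h
  · exact Finset.mem_filter.2 ⟨Finset.mem_univ _, h, Or.inl rfl⟩
  · exact Finset.mem_filter.2 ⟨Finset.mem_univ _, h, Or.inr rfl⟩
  · rintro ⟨hab, j, ha, hb⟩
    obtain ⟨-, hj, ha⟩ := Finset.mem_filter.1 ha
    obtain ⟨-, -, hb⟩ := Finset.mem_filter.1 hb
    rcases ha with rfl | rfl <;> rcases hb with rfl | rfl
    · exact absurd rfl hab
    · exact hj
    · exact G.bi_symm _ _ hj
    · exact absurd rfl hab

/-- The values in the model `toSCM`. -/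
noncomputable def run (G : CausalDiagram V) (Y : V) (val : D ↪ ℝ)
    (f : ∀ v, ({p // G.dir p v} → D) → ({j // G.Acts j v} → Bool) → D)
    (X : Finset V) (x : V → D) (e : V × V → Bool) : V → D :=
  (G.toSCM Y val f).solve X x e

lemma run_of_mem {X : Finset V} {x : V → D} {e : V × V → Bool} {v : V} (hv : v ∈ X) :
    G.run Y val f X x e v = x v :=
  (SCM.solve_eq _ _ _ _ _).trans (if_pos hv)

lemma run_of_notMem {X : Finset V} {x : V → D} {e : V × V → Bool} {v : V} (hv : v ∉ X) :
    G.run Y val f X x e v = f v (fun p => G.run Y val f X x e p) (fun j => e j) :=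
  (SCM.solve_eq _ _ _ _ _).trans (if_neg hv)

lemma expectedReward_toSCM (X : Finset V) (x : V → D) :
    (G.toSCM Y val f).expectedReward X x =
      ∫ e, val (G.run Y val f X x e Y)
        ∂Measure.pi fun _ : V × V => (PMF.uniformOfFintype Bool).toMeasure := rfl

lemma expectedReward_toSCM_of_const {X : Finset V} {x : V → D} {d : D}
    (h : ∀ e, G.run Y val f X x e Y = d) : (G.toSCM Y val f).expectedReward X x = val d := by
  simp [expectedReward_toSCM, h]

lemma dir_induction (G : CausalDiagram V) {P : V → Prop} (h : ∀ v, (∀ p, G.dir p v → P p) → P v)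
    (v : V) : P v := by
  have : IsTrans V (TransGen G.dir) := inferInstance
  have : Std.Irrefl (TransGen G.dir) := ⟨G.acyclic⟩
  refine (Finite.wellFounded_of_trans_of_irrefl (TransGen G.dir)).induction v fun v ih => ?_
  exact h v fun p hp => ih p (TransGen.single hp)

/-- If a border vertex `x` is not in `R`, take Boolean disjunctions of the parents, with `x` itself
constantly false. Setting `x` to true, possible only by intervening on it, sends a signal to `Y`
through `T`. -/
lemma IsTerritory.border_subset_of_rewardEquivalent {T : Finset V} (hT : G.IsTerritory Y T)
    {R : Finset V} (h : RewardEquivalent G Y R (G.border T)) :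
    G.border T ⊆ R := by
  classical
  intro x hx
  by_contra hxR
  obtain ⟨hxT, t, ht, hxt⟩ := mem_border.1 hx
  let val : Bool ↪ ℝ := ⟨fun b => if b then 1 else 0, by
    intro a b
    cases a <;> cases b <;> simp⟩
  let f : ∀ v, ({p // G.dir p v} → Bool) → ({j // G.Acts j v} → Bool) → Bool :=
    fun v c _ => decide (v ≠ x ∧ ∃ p, c p = true)
  let a : V → Bool := fun v => decide (v = x)
  have h1 : ∀ e v, G.run Y val f R a e v = false := by
    intro e v
    induction v using G.dir_induction with
    | _ v ih =>
      by_cases hv : v ∈ R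
      · rw [run_of_mem hv]
        simp only [a, decide_eq_false_iff_not]
        rintro rfl
        exact hxR hv
      · rw [run_of_notMem hv]
        simp only [f, decide_eq_false_iff_not, not_and]
        rintro - ⟨p, hp⟩
        exact Bool.false_ne_true ((ih p p.2).symm.trans hp)
  have h2 : ∀ e, G.run Y val f (G.border T) a e Y = true := by
    intro e
    have hstep : ∀ v w, w ∈ T → G.dir v w → G.run Y val f (G.border T) a e v = true →
        G.run Y val f (G.border T) a e w = true := by
      intro v w hw hvw hv
      rw [run_of_notMem fun hwX => (mem_border.1 hwX).1 hw]
      simp only [f, decide_eq_true_eq]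
      exact ⟨fun hwx => hxT (hwx ▸ hw), ⟨v, hvw⟩, hv⟩
    have hx1 : G.run Y val f (G.border T) a e x = true := by
      rw [run_of_mem hx]
      simp [a]
    have ht1 := hstep x t ht hxt hx1
    have hp := hT.path t ht
    revert ht1
    generalize t = t' at hp
    induction hp using ReflTransGen.head_induction_on with
    | refl => exact id
    | head hac _ ih => exact fun h => ih (hstep _ _ hac.2 hac.1 h)
  have := h (G.toSCM Y val f) toSCM_conforms a
  rw [expectedReward_toSCM_of_const fun e => h1 e Y, expectedReward_toSCM_of_const h2] at this
  simp [val] at this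

end Model

/-! ### The relay model -/

/-- The exogenous variable `j` acts on an ancestor of `p` inside `T`. -/
def Reports (G : CausalDiagram V) (T : Finset V) (p : V) (j : V × V) : Prop :=
  ∃ b ∈ T, G.Acts j b ∧ ReflTransGen (fun a b => G.dir a b ∧ b ∈ T) b p

variable {T : Finset V} {E : Type} {enc : V × V ≃ E}

lemma Reports.tail {p q : V} {j : V × V} (h : G.Reports T p j) (hpq : G.dir p q) (hq : q ∈ T) :
    G.Reports T q j := by
  obtain ⟨b, hb, hj, hp⟩ := h
  exact ⟨b, hb, hj, hp.tail ⟨hpq, hq⟩⟩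

lemma IsTerritory.ne_of_dir (hT : G.IsTerritory Y T) {p v : V} (hv : v ∈ T) (hpv : G.dir p v) :
    p ≠ Y := by
  rintro rfl
  exact G.acyclic p (TransGen.head' hpv (ReflTransGen.mono (fun _ _ h => h.1) _ _ (hT.path v hv)))

/-- The coin values `g` agree with the coins `u` seen at `v` and with the reports of all parents
of `v`. -/
def Consistent (G : CausalDiagram V) (T : Finset V) (enc : V × V ≃ E) (v : V)
    (c : {p // G.dir p v} → Option (E → Bool)) (u : {j // G.Acts j v} → Bool)
    (g : E → Bool) : Prop :=
  (∀ j, u j = g (enc j)) ∧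
    ∀ p, ∃ h, c p = some h ∧ ∀ j, G.Reports T p j → h (enc j) = g (enc j)

open Classical in
/-- Every vertex of `T` relays the coin values that it knows of, or `none` if its information is
inconsistent; `Y` takes the value `d₁` if its information is consistent, and `d₀` otherwise. -/
noncomputable def relay (G : CausalDiagram V) (Y : V) (T : Finset V) (enc : V × V ≃ E)
    (d₀ d₁ : Option (E → Bool)) (v : V) (c : {p // G.dir p v} → Option (E → Bool))
    (u : {j // G.Acts j v} → Bool) : Option (E → Bool) :=
  if h : v ∈ T ∧ ∃ g, G.Consistent T enc v c u g then
    if v = Y then d₁ else some h.2.choose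
  else if v = Y then d₀ else none

section Run

variable [Fintype E] [DecidableEq E] {val : Option (E → Bool) ↪ ℝ} {d₀ d₁ : Option (E → Bool)} {W : Finset V}
  {x : V → Option (E → Bool)} {e : V × V → Bool}

/-- At `v`, the coin values `g` are consistent with what is seen under the intervention `x[W]`. -/
def ConsistentAt (G : CausalDiagram V) (Y : V) (T : Finset V) (enc : V × V ≃ E)
    (val : Option (E → Bool) ↪ ℝ) (d₀ d₁ : Option (E → Bool)) (W : Finset V)
    (x : V → Option (E → Bool)) (e : V × V → Bool) (v : V) (g : E → Bool) : Prop :=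
  (∀ j, G.Acts j v → e j = g (enc j)) ∧
    ∀ p, G.dir p v → ∃ h, G.run Y val (G.relay Y T enc d₀ d₁) W x e p = some h ∧
      ∀ j, G.Reports T p j → h (enc j) = g (enc j)

lemma consistent_iff {v : V} {g : E → Bool} :
    G.Consistent T enc v (fun p => G.run Y val (G.relay Y T enc d₀ d₁) W x e p)
      (fun j => e j) g ↔ G.ConsistentAt Y T enc val d₀ d₁ W x e v g := by
  simp only [Consistent, ConsistentAt, Subtype.forall]

lemma run_relay_Y (hYT : Y ∈ T) (hW : Y ∉ W) :
    ((∃ g, G.ConsistentAt Y T enc val d₀ d₁ W x e Y g) ∧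
      G.run Y val (G.relay Y T enc d₀ d₁) W x e Y = d₁) ∨
    ((¬ ∃ g, G.ConsistentAt Y T enc val d₀ d₁ W x e Y g) ∧
      G.run Y val (G.relay Y T enc d₀ d₁) W x e Y = d₀) := by
  simp only [run_of_notMem hW, ← consistent_iff]
  by_cases h : ∃ g, G.Consistent T enc Y
      (fun p => G.run Y val (G.relay Y T enc d₀ d₁) W x e p) (fun j => e j) g
  · exact Or.inl ⟨h, by rw [relay, dif_pos ⟨hYT, h⟩, if_pos rfl]⟩
  · exact Or.inr ⟨h, by rw [relay, dif_neg fun h' => h h'.2, if_pos rfl]⟩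

lemma run_relay_of_notMem (hYT : Y ∈ T) {v : V} (hv : v ∉ T) (hW : v ∉ W) :
    G.run Y val (G.relay Y T enc d₀ d₁) W x e v = none := by
  rw [run_of_notMem hW, relay, dif_neg fun h => hv h.1, if_neg]
  rintro rfl
  exact hv hYT

lemma run_relay_of_mem {v : V} (hv : v ∈ T) (hW : v ∉ W) (hvY : v ≠ Y) {g : E → Bool}
    (hg : G.ConsistentAt Y T enc val d₀ d₁ W x e v g) :
    ∃ h, G.run Y val (G.relay Y T enc d₀ d₁) W x e v = some h ∧
      G.ConsistentAt Y T enc val d₀ d₁ W x e v h := by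
  have hex := (⟨g, consistent_iff.2 hg⟩ : ∃ g, G.Consistent T enc v
    (fun p => G.run Y val (G.relay Y T enc d₀ d₁) W x e p) (fun j => e j) g)
  refine ⟨hex.choose, ?_, consistent_iff.1 hex.choose_spec⟩
  rw [run_of_notMem hW, relay, dif_pos ⟨hv, hex⟩, if_neg hvY]

lemma consistentAt_of_run_eq_some {v : V} (hW : v ∉ W) (hvY : v ≠ Y) {h : E → Bool}
    (hrun : G.run Y val (G.relay Y T enc d₀ d₁) W x e v = some h) :
    G.ConsistentAt Y T enc val d₀ d₁ W x e v h := by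
  rw [run_of_notMem hW, relay] at hrun
  split_ifs at hrun with hex
  · rw [← consistent_iff, ← Option.some.inj hrun]
    exact hex.2.choose_spec

/-- Consistency at `Y` propagates backwards along paths that are not intervened on. -/
lemma exists_consistentAt_of_path {gY : E → Bool}
    (hgY : G.ConsistentAt Y T enc val d₀ d₁ W x e Y gY) {v : V} (hvW : v ∉ W)
    (hp : ReflTransGen (fun a b => G.dir a b ∧ b ∈ T ∧ b ∉ W) v Y) :
    ∃ g, G.ConsistentAt Y T enc val d₀ d₁ W x e v g ∧
      ∀ j, G.Reports T v j → g (enc j) = gY (enc j) := by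
  induction hp using ReflTransGen.head_induction_on with
  | refl => exact ⟨gY, hgY, fun _ _ => rfl⟩
  | @head v w hvw hwY ih =>
    obtain ⟨g, hg, hgj⟩ := ih hvw.2.2
    obtain ⟨h, hh, hhj⟩ := hg.2 v hvw.1
    have hvY : v ≠ Y := by
      rintro rfl
      exact G.acyclic v (TransGen.head' hvw.1 (ReflTransGen.mono (fun _ _ h => h.1) _ _ hwY))
    exact ⟨h, consistentAt_of_run_eq_some hvW hvY hh, fun j hj =>
      (hhj j hj).trans (hgj j (hj.tail hvw.1 hvw.2.1))⟩

/-- The true coin table is consistent at every vertex of `T`. A vertex may relay another table, but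
by induction along the edges it is correct on every coin that the vertex reports. -/
lemma consistentAt_of_border_subset (hT : G.IsTerritory Y T) (hX : G.border T ⊆ W) (hWT : Disjoint W T)
    (hx : ∀ v ∈ W, (x v).isSome) {v : V} (hv : v ∈ T) :
    G.ConsistentAt Y T enc val d₀ d₁ W x e v (fun i => e (enc.symm i)) := by
  have key : ∀ v, v ∈ T → G.ConsistentAt Y T enc val d₀ d₁ W x e v (fun i => e (enc.symm i)) ∧
      (v ≠ Y → ∃ h, G.run Y val (G.relay Y T enc d₀ d₁) W x e v = some h ∧
        ∀ j, G.Reports T v j → h (enc j) = e j) := by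
    intro v
    induction v using G.dir_induction with
    | _ v ih =>
      intro hv
      have hc : G.ConsistentAt Y T enc val d₀ d₁ W x e v (fun i => e (enc.symm i)) := by
        refine ⟨fun j _ => by simp, fun p hp => ?_⟩
        simp only [Equiv.symm_apply_apply]
        by_cases hpT : p ∈ T
        · exact (ih p hp hpT).2 (hT.ne_of_dir hv hp)
        · have hpW := hX (mem_border.2 ⟨hpT, v, hv, hp⟩)
          obtain ⟨h, hh⟩ := Option.isSome_iff_exists.1 (hx p hpW)
          refine ⟨h, (run_of_mem hpW).trans hh, ?_⟩
          -- A vertex outside `T` reports no coin; its value only has to differ from `none`.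
          rintro j ⟨b, hb, -, hbp⟩
          exact absurd (mem_of_path hbp hb) hpT
      refine ⟨hc, fun hvY => ?_⟩
      have hvW : v ∉ W := Finset.disjoint_right.1 hWT hv
      obtain ⟨h, hh, hch⟩ := run_relay_of_mem hv hvW hvY hc
      refine ⟨h, hh, ?_⟩
      rintro j ⟨b, hb, hj, hbv⟩
      rcases hbv.cases_tail with rfl | ⟨p, hbp, hpv⟩
      · exact (hch.1 j hj).symm
      · have hpT := mem_of_path hbp hb
        obtain ⟨h', hh', hj'⟩ := (ih p hpv.1 hpT).2 (hT.ne_of_dir hv hpv.1)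
        obtain ⟨h'', hh'', hj''⟩ := hch.2 p hpv.1
        have hr : G.Reports T p j := ⟨b, hb, hj, hbp⟩
        rw [hh'] at hh''
        rw [← hj'' j hr, ← Option.some.inj hh'', hj' j hr]
  exact (key v hv).1

/-- If vertices of a territory are intervened on, then some bidirected edge joins a vertex with an
untouched path to `Y` to an ancestor of an intervened vertex that is seen on an untouched path. -/
lemma IsTerritory.exists_split (hT : G.IsTerritory Y T) (hW : Y ∉ W) (hWT : ¬ Disjoint W T) :
    ∃ a b s d, a ∈ T ∧ a ∉ W ∧
      ReflTransGen (fun a b => G.dir a b ∧ b ∈ T ∧ b ∉ W) a Y ∧ b ∈ T ∧ G.bi a b ∧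
      ReflTransGen (fun a b => G.dir a b ∧ b ∈ T) b s ∧ s ∈ W ∧ G.dir s d ∧ d ∈ T ∧ d ∉ W ∧
      ReflTransGen (fun a b => G.dir a b ∧ b ∈ T ∧ b ∉ W) d Y := by
  by_contra! hno
  let step : V → V → Prop := fun a b => G.dir a b ∧ b ∈ T
  let free : V → V → Prop := fun a b => G.dir a b ∧ b ∈ T ∧ b ∉ W
  -- `P v` says that no path in `T` from `v` leads to an intervened vertex with a child seen by `Y`.
  -- Without the desired edge, `P` propagates from `Y` to all of `T`.
  let P : V → Prop := fun v => ∀ s d, ReflTransGen step v s → s ∈ W → G.dir s d → d ∈ T → d ∉ W →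
    ReflTransGen free d Y → False
  -- On a path to `Y` inside `T`, the last intervened vertex, if any, refutes `P v`.
  have hsplit : ∀ v ∈ T, (v ∉ W ∧ ReflTransGen free v Y) ∨ ¬ P v := by
    intro v hv
    have hp := hT.path v hv
    induction hp using ReflTransGen.head_induction_on with
    | refl => exact Or.inl ⟨hW, ReflTransGen.refl⟩
    | @head v w hvw _ ih =>
      rcases ih hvw.2 with h | h
      · by_cases hvW : v ∈ W
        · exact Or.inr fun hP => hP v w ReflTransGen.refl hvW hvw.1 hvw.2 h.1 h.2
        · exact Or.inl ⟨hvW, h.2.head ⟨hvw.1, hvw.2, h.1⟩⟩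
      · exact Or.inr fun hP => h fun s d hs => hP s d (hs.head hvw)
  have hP : ∀ v ∈ T, P v := by
    refine hT.minimal P ?_ ?_ ?_
    · intro s d hs _ hd hdT _ _
      have hsY : TransGen G.dir Y d :=
        TransGen.tail' (ReflTransGen.mono (fun _ _ h => h.1) _ _ hs) hd
      exact G.acyclic Y (hsY.trans_left (ReflTransGen.mono (fun _ _ h => h.1) _ _ (hT.path d hdT)))
    · intro v _ hv w hw hvw s d hs
      exact hv s d (hs.head ⟨hvw, hw⟩)
    · intro v hvT hv w hw hvw s d hs hsW hd hdT hdW hdY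
      obtain ⟨h1, h2⟩ := (hsplit v hvT).resolve_right (not_not.2 hv)
      exact hno v w s d hvT h1 h2 hw hvw hs hsW hd hdT hdW hdY
  obtain ⟨v, hvW, hvT⟩ := Finset.not_disjoint_iff.1 hWT
  exact ((hsplit v hvT).resolve_right (not_not.2 (hP v hvT))).1 hvW

/-- Unless the border of the territory is intervened on and the territory is not, there is a coin of
which one side leads to the value `d₀` of `Y`. -/
lemma IsTerritory.exists_coin (hT : G.IsTerritory Y T) (hW : Y ∉ W)
    (h : ¬ (G.border T ⊆ W ∧ Disjoint W T)) (val : Option (E → Bool) ↪ ℝ)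
    (d₀ d₁ : Option (E → Bool)) (enc : V × V ≃ E) (x : V → Option (E → Bool)) :
    ∃ j b, ∀ e : V × V → Bool, e j = b →
      G.run Y val (G.relay Y T enc d₀ d₁) W x e Y = d₀ := by
  suffices ∃ j b, ∀ e : V × V → Bool, e j = b →
      ¬ ∃ g, G.ConsistentAt Y T enc val d₀ d₁ W x e Y g by
    obtain ⟨j, b, hj⟩ := this
    refine ⟨j, b, fun e he => ?_⟩
    rcases run_relay_Y (val := val) (d₀ := d₀) (d₁ := d₁) (enc := enc) (x := x) (e := e)
      hT.mem hW with h | h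
    · exact absurd h.1 (hj e he)
    · exact h.2
  by_cases hWT : Disjoint W T
  · have hXW : ¬ G.border T ⊆ W := fun hX => h ⟨hX, hWT⟩
    obtain ⟨v, hvX, hvW⟩ := Finset.not_subset.1 hXW
    obtain ⟨hvT, t, ht, hvt⟩ := mem_border.1 hvX
    -- An unset border vertex sends `none`, which spoils consistency whatever the coins, so this
    -- coin and side are arbitrary.
    refine ⟨(Y, Y), false, fun e _ ⟨gY, hgY⟩ => ?_⟩
    have htW := Finset.disjoint_right.1 hWT ht
    obtain ⟨g, hg, -⟩ := exists_consistentAt_of_path hgY htW <| by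
      have hp := hT.path t ht
      exact ReflTransGen.mono (fun a b h => ⟨h.1, h.2, Finset.disjoint_right.1 hWT h.2⟩) _ _ hp
    obtain ⟨k, hk, -⟩ := hg.2 v hvt
    rw [run_relay_of_notMem hT.mem hvT hvW] at hk
    exact Option.some_ne_none k hk.symm
  · obtain ⟨a, b, s, d, haT, haW, haY, hbT, hab, hbs, hsW, hsd, hdT, hdW, hdY⟩ :=
      hT.exists_split hW hWT
    have ha : G.Acts (a, b) a := ⟨hab, Or.inl rfl⟩
    have hrs : G.Reports T s (a, b) := ⟨b, hbT, ⟨hab, Or.inr rfl⟩, hbs⟩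
    -- Through `a`, `Y` learns the true coin; through `d`, it learns the entry of the table imposed
    -- on `s`. The chosen side contradicts that entry. If `x s` is `none`, consistency fails anyway
    -- and the default is harmless.
    refine ⟨(a, b), !((x s).elim false fun k => k (enc (a, b))), fun e he ⟨gY, hgY⟩ => ?_⟩
    obtain ⟨g, hg, hgj⟩ := exists_consistentAt_of_path hgY haW haY
    obtain ⟨g', hg', hgj'⟩ := exists_consistentAt_of_path hgY hdW hdY
    obtain ⟨k, hk, hkj⟩ := hg'.2 s hsd
    rw [run_of_mem hsW] at hk
    rw [hk, hg.1 _ ha, hgj _ ⟨a, haT, ha, ReflTransGen.refl⟩, Option.elim_some, hkj _ hrs,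
      hgj' _ (hrs.tail hsd hdT)] at he
    exact Bool.not_ne_self _ he.symm

/-- The deficit `val d₁ - val Y` is nonnegative, and positive on an event of positive probability.
-/
lemma expectedReward_lt_of_coin {D : Type} [Fintype D] [Nonempty D] {val : D ↪ ℝ}
    {f : ∀ v, ({p // G.dir p v} → D) → ({j // G.Acts j v} → Bool) → D} {d₀ d₁ : D}
    (hd : val d₀ < val d₁) {W : Finset V} {x : V → D}
    (hle : ∀ e, G.run Y val f W x e Y = d₀ ∨ G.run Y val f W x e Y = d₁) {j : V × V} {b : Bool}
    (hj : ∀ e : V × V → Bool, e j = b → G.run Y val f W x e Y = d₀) :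
    (G.toSCM Y val f).expectedReward W x < val d₁ := by
  rw [expectedReward_toSCM]
  set μ := Measure.pi fun _ : V × V => (PMF.uniformOfFintype Bool).toMeasure
  have hint : Integrable (fun e => val (G.run Y val f W x e Y)) μ := Integrable.of_finite
  have hpos : 0 < ∫ e, (val d₁ - val (G.run Y val f W x e Y)) ∂μ := by
    rw [integral_pos_iff_support_of_nonneg (μ := μ)
      (f := fun e => val d₁ - val (G.run Y val f W x e Y)) _ ((integrable_const _).sub hint)]
    · have hev : μ ((fun e => e j) ⁻¹' {b}) = (PMF.uniformOfFintype Bool).toMeasure {b} :=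
        (measurePreserving_eval _ j).measure_preimage (measurableSet_singleton b).nullMeasurableSet
      have hb : 0 < μ ((fun e => e j) ⁻¹' {b}) := by
        rw [hev, PMF.toMeasure_apply_singleton _ _ (measurableSet_singleton b)]
        simp
      refine hb.trans_le (measure_mono fun e he => ?_)
      simp only [Function.mem_support]
      rw [hj e he]
      exact (sub_pos.2 hd).ne'
    · intro e
      rcases hle e with h | h <;> simp [h, hd.le]
  rw [integral_sub (integrable_const _) hint] at hpos
  simpa using hpos

end Run

/-- In some model, an intervention on `R` that contains the border of a territory and is disjoint
from it beats all those that do not have this property. -/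
theorem IsTerritory.exists_model (hT : G.IsTerritory Y T) {R : Finset V} (hXR : G.border T ⊆ R)
    (hRT : Disjoint R T) :
    ∃ M : SCM V Y, M.Conforms G ∧ ∀ W : Finset V, Y ∉ W →
      ¬ (G.border T ⊆ W ∧ Disjoint W T) → M.bestReward W < M.bestReward R := by
  -- Coins are indexed by `Fin` because domains live in `Type`, while `V` lives in `Type u`.
  let enc : V × V ≃ Fin (Fintype.card (V × V)) := Fintype.equivFin _
  let D := Option (Fin (Fintype.card (V × V)) → Bool)
  let val : D ↪ ℝ := (Fintype.equivFin D).toEmbedding.trans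
    (Fin.valEmbedding.trans Nat.castEmbedding)
  obtain ⟨d₀, d₁, hd⟩ : ∃ d₀ d₁ : D, val d₀ < val d₁ := by
    have hne : val none ≠ val (some fun _ => false) := val.injective.ne (by simp)
    rcases hne.lt_or_gt with h | h
    · exact ⟨_, _, h⟩
    · exact ⟨_, _, h⟩
  refine ⟨G.toSCM Y val (G.relay Y T enc d₀ d₁), toSCM_conforms, fun W hW h => ?_⟩
  have hR : val d₁ ≤ (G.toSCM Y val (G.relay Y T enc d₀ d₁)).bestReward R := by
    have hYR : Y ∉ R := Finset.disjoint_right.1 hRT hT.mem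
    have := SCM.expectedReward_le_bestReward (G.toSCM Y val (G.relay Y T enc d₀ d₁)) R
      (fun _ => (some fun _ => false : D))
    rwa [expectedReward_toSCM_of_const (d := d₁)] at this
    intro e
    rcases run_relay_Y (val := val) (d₀ := d₀) (d₁ := d₁) (enc := enc)
      (x := fun _ => (some fun _ => false : D)) (e := e) hT.mem hYR with h | h
    · exact h.2
    · exact absurd ⟨_, consistentAt_of_border_subset hT hXR hRT (by simp) hT.mem⟩ h.1
  refine lt_of_lt_of_le ?_ hR
  -- The coin depends on the assignment; the strict bound survives because the maximum is attained.
  obtain ⟨x, hx⟩ := exists_eq_ciSup_of_finite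
    (f := fun x => (G.toSCM Y val (G.relay Y T enc d₀ d₁)).expectedReward W x)
  rw [SCM.bestReward, ← hx]
  obtain ⟨j, b, hj⟩ := hT.exists_coin hW h val d₀ d₁ enc x
  refine expectedReward_lt_of_coin hd (fun e => ?_) hj
  rcases run_relay_Y (val := val) (d₀ := d₀) (d₁ := d₁) (enc := enc) (x := x) (e := e)
    hT.mem hW with h | h
  · exact Or.inr h.2
  · exact Or.inl h.2

theorem isPOIS_iff (hY : Y ∈ G.verts) (R : Finset V) :
    IsPOIS G Y R ↔ ∃ T, G.IsTerritory Y T ∧ R ∈ G.between (G.border T) T := by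
  simp only [mem_between]
  constructor
  · rintro ⟨hRA, M, hM, hbest⟩
    have hYR : Y ∉ R := fun h => by simpa using hRA h
    have hc := isCutTo_cutIncoming hY hYR
    have hT := hc.isTerritory_muct
    have hRT := Finset.subset_compl_iff_disjoint_left.1 hc.muct_subset
    have hbR := M.bestReward_le_border hM hY hYR
    refine ⟨_, hT, ?_, ?_⟩
    · refine hT.border_subset_of_rewardEquivalent ?_
      -- Otherwise the POIS would strictly beat the border, which does at least as well.
      by_contra hne
      exact (hbest _ (fun h => (mem_border.1 h).1 hT.mem) hne).not_ge hbR
    · rw [hT.ancestors_eq]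
      exact fun v hv => Finset.mem_sdiff.2
        ⟨(Finset.mem_sdiff.1 (hRA hv)).1, Finset.disjoint_left.1 hRT hv⟩
  · rintro ⟨T, hT, hXR, hRA⟩
    rw [hT.ancestors_eq, Finset.subset_sdiff] at hRA
    obtain ⟨M, hM, hbest⟩ := hT.exists_model hXR hRA.2
    refine ⟨Finset.subset_sdiff.2 ⟨hRA.1, ?_⟩, M, hM, fun W hW hne => hbest W hW fun h => hne ?_⟩
    · exact Finset.disjoint_singleton_right.2 (Finset.disjoint_right.1 hRA.2 hT.mem)
    · exact SCM.rewardEquivalent_of_border_subset hT.mem hXR h.1 hRA.2 h.2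

end CausalDiagram

theorem mainTheorem8 {V : Type u} [Fintype V] [DecidableEq V] (G : CausalDiagram V)
    (hV : G.verts = Finset.univ) (Y : V) :
    (∃ l : List V, (G.startDiagram Y).IsTopologicalSort l) ∧
      ∀ l : List V, (G.startDiagram Y).IsTopologicalSort l →
        ∀ R : Finset V, R ∈ G.POISs Y l ↔ IsPOIS G Y R := by
  have hY : Y ∈ G.verts := hV ▸ Finset.mem_univ Y
  exact ⟨CausalDiagram.exists_isTopologicalSort _, fun l hl R =>
    (CausalDiagram.mem_POISs_iff hY hl R).trans (CausalDiagram.isPOIS_iff hY R).symm⟩
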